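/- Let $n\ge 2$, let $\Omega\subset\mathbb{R}^n$ be a bounded domain (non-empty, open, connected), let $2\le p\le\infty$, and put $\Omega_\infty=\Omega\times(0,\infty)$ and $P_\infty=(\overline\Omega\times\{0\})\cup(\partial\Omega\times(0,\infty))$. Write $$\Gamma_p u=\operatorname{div}(|Du|^{p-2}Du)-(p-1)u^{p-2}u_t\quad(2\le p<\infty),\qquad \Gamma_\infty u=\sum_{i,j=1}^n D_iu\,D_ju\,D_{ij}u-3u^2u_t,$$ where $D$ is the gradient in $x$. A positive continuous function $u$ on $\Omega_\infty$ is a viscosity solution of $\Gamma_pu=0$ if, for every $\psi$ on $\Omega_\infty$ that is $C^2$ in $x$ and $C^1$ in $t$ and every $(y,s)\in\Omega_\infty$, the number $$\operatorname{div}(|D\psi|^{p-2}D\psi)(y,s)-(p-1)u(y,s)^{p-2}\psi_t(y,s)\quad\Big(\text{for }p=\infty:\ \sum_{i,j}D_i\psi D_j\psi D_{ij}\psi(y,s)-3u(y,s)^2\psi_t(y,s)\Big)$$ is $\ge0$ whenever $u-\psi$ has a local maximum at $(y,s)$, and $\le0$ whenever $u-\psi$ has a local minimum at $(y,s)$. Let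 $f:\overline\Omega\to\mathbb{R}$ be such that the function equal to $f$ on $\overline\Omega\times\{0\}$ and to $1$ on $\partial\Omega\times(0,\infty)$ is continuous on $P_\infty$, and suppose $0<\inf_\Omega f\le1\le\sup_\Omega f<\infty$. Let $u\in C(\Omega_\infty\cup P_\infty)$, $u>0$, be a viscosity solution of $\Gamma_pu=0$ in $\Omega_\infty$ with $u(x,0)=f(x)$ for all $x\in\overline\Omega$ and $u(x,t)=1$ for all $(x,t)\in\partial\Omega\times[0,\infty)$. Then $\lim_{t\to\infty}u(x,t)=1$ for every $x\in\Omega$. Moreover, as $t\to\infty$, uniformly in $x\in\Omega$: (i) if $p=2$, then $u(x,t)=\exp(O(t^{-s}))$ for every $s>0$; (ii) if $2<p<\infty$, then $u(x,t)=\exp(O(t^{-1/(p-2)}))$; (iii) if $p=\infty$, then $u(x,t)=\exp(O(t^{-1/2}))$. -/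

import Mathlib

open Set Filter Topology Asymptotics
open scoped ENNReal

noncomputable section

namespace Trudinger

/-- The `i`-th partial derivative of a function on `ℝⁿ`. -/
def partialD {n : ℕ} (i : Fin n) (φ : EuclideanSpace ℝ (Fin n) → ℝ)
    (x : EuclideanSpace ℝ (Fin n)) : ℝ :=
  fderiv ℝ φ x (EuclideanSpace.single i 1)

/-- The divergence of a vector field on `ℝⁿ`. -/
def divergence {n : ℕ} (F : EuclideanSpace ℝ (Fin n) → EuclideanSpace ℝ (Fin n))
    (x : EuclideanSpace ℝ (Fin n)) : ℝ :=
  ∑ i, (fderiv ℝ F x (EuclideanSpace.single i 1)) i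

/-- `Δ_p φ = div (|Dφ|^(p-2) Dφ)`; for `2 ≤ p` and `φ` of class `C²` the vector field is `C¹`,
also where `Dφ = 0`. -/
def pLaplacian {n : ℕ} (p : ℝ) (φ : EuclideanSpace ℝ (Fin n) → ℝ)
    (x : EuclideanSpace ℝ (Fin n)) : ℝ :=
  divergence (fun y => ‖gradient φ y‖ ^ (p - 2) • gradient φ y) x

/-- `Δ_∞ φ = ∑ D_i φ D_j φ D_ij φ`. -/
def inftyLaplacian {n : ℕ} (φ : EuclideanSpace ℝ (Fin n) → ℝ)
    (x : EuclideanSpace ℝ (Fin n)) : ℝ :=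
  ∑ i, ∑ j, partialD i φ x * partialD j φ x * partialD i (partialD j φ) x

/-- The time derivative `ψ_t`. -/
def timeD {n : ℕ} (ψ : EuclideanSpace ℝ (Fin n) × ℝ → ℝ)
    (z : EuclideanSpace ℝ (Fin n) × ℝ) : ℝ :=
  deriv (fun s => ψ (z.1, s)) z.2

/-- The spatial gradient `Dψ`. -/
def spaceGrad {n : ℕ} (ψ : EuclideanSpace ℝ (Fin n) × ℝ → ℝ)
    (z : EuclideanSpace ℝ (Fin n) × ℝ) : EuclideanSpace ℝ (Fin n) :=
  gradient (fun y => ψ (y, z.2)) z.1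

/-- The spatial Hessian `D²ψ`. -/
def spaceHess {n : ℕ} (ψ : EuclideanSpace ℝ (Fin n) × ℝ → ℝ)
    (z : EuclideanSpace ℝ (Fin n) × ℝ) :
    EuclideanSpace ℝ (Fin n) →L[ℝ] EuclideanSpace ℝ (Fin n) :=
  fderiv ℝ (fun y => spaceGrad ψ (y, z.2)) z.1

/-- `Δ_p ψ - (p-1) c^(p-2) ψ_t` if `p < ∞`, and `Δ_∞ ψ - 3 c² ψ_t` if `p = ∞`, at the point `z`.
With `c = u z` this is the operator `Γ_p` tested on `ψ` at a touching point `z` of `u`. -/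
def gammaOp {n : ℕ} (p : ℝ≥0∞) (c : ℝ) (ψ : EuclideanSpace ℝ (Fin n) × ℝ → ℝ)
    (z : EuclideanSpace ℝ (Fin n) × ℝ) : ℝ :=
  if p = ⊤ then
    inftyLaplacian (fun y => ψ (y, z.2)) z.1 - 3 * c ^ 2 * timeD ψ z
  else
    pLaplacian p.toReal (fun y => ψ (y, z.2)) z.1
      - (p.toReal - 1) * c ^ (p.toReal - 2) * timeD ψ z

/-- `ψ` is `C²` in `x` and `C¹` in `t` on the open set `Q`: the derivatives `Dψ`, `D²ψ`, `ψ_t`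
exist and, with `ψ`, are continuous on `Q`. -/
structure IsTestFunction {n : ℕ} (Q : Set (EuclideanSpace ℝ (Fin n) × ℝ))
    (ψ : EuclideanSpace ℝ (Fin n) × ℝ → ℝ) : Prop where
  contDiffAt_space : ∀ z ∈ Q, ContDiffAt ℝ 2 (fun y => ψ (y, z.2)) z.1
  differentiableAt_time : ∀ z ∈ Q, DifferentiableAt ℝ (fun s => ψ (z.1, s)) z.2
  continuousOn : ContinuousOn ψ Q
  continuousOn_grad : ContinuousOn (spaceGrad ψ) Q
  continuousOn_hess : ContinuousOn (spaceHess ψ) Q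
  continuousOn_time : ContinuousOn (timeD ψ) Q

/-- Positive viscosity sub-solutions of `Γ_p w = 0` in the open set `Q`. -/
structure IsSubsolution {n : ℕ} (p : ℝ≥0∞) (Q : Set (EuclideanSpace ℝ (Fin n) × ℝ))
    (u : EuclideanSpace ℝ (Fin n) × ℝ → ℝ) : Prop where
  usc : UpperSemicontinuousOn u Q
  pos : ∀ z ∈ Q, 0 < u z
  test : ∀ ψ, IsTestFunction Q ψ → ∀ z ∈ Q, IsLocalMax (fun w => u w - ψ w) z →
    0 ≤ gammaOp p (u z) ψ z

/-- Positive viscosity super-solutions of `Γ_p w = 0` in the open set `Q`. -/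
structure IsSupersolution {n : ℕ} (p : ℝ≥0∞) (Q : Set (EuclideanSpace ℝ (Fin n) × ℝ))
    (u : EuclideanSpace ℝ (Fin n) × ℝ → ℝ) : Prop where
  lsc : LowerSemicontinuousOn u Q
  pos : ∀ z ∈ Q, 0 < u z
  test : ∀ ψ, IsTestFunction Q ψ → ∀ z ∈ Q, IsLocalMin (fun w => u w - ψ w) z →
    gammaOp p (u z) ψ z ≤ 0

/-- Positive viscosity solutions of `Γ_p w = 0` in the open set `Q`. -/
structure IsViscositySolution {n : ℕ} (p : ℝ≥0∞) (Q : Set (EuclideanSpace ℝ (Fin n) × ℝ))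
    (u : EuclideanSpace ℝ (Fin n) × ℝ → ℝ) : Prop where
  continuousOn : ContinuousOn u Q
  sub : IsSubsolution p Q u
  super : IsSupersolution p Q u

/-- `Ω_∞ = Ω × (0, ∞)`. -/
def cylinder {n : ℕ} (Ω : Set (EuclideanSpace ℝ (Fin n))) :
    Set (EuclideanSpace ℝ (Fin n) × ℝ) :=
  Ω ×ˢ Ioi 0

/-- The parabolic boundary `P_∞` of `Ω × (0, ∞)`. -/
def parabolicBoundary {n : ℕ} (Ω : Set (EuclideanSpace ℝ (Fin n))) :
    Set (EuclideanSpace ℝ (Fin n) × ℝ) :=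
  (closure Ω ×ˢ {0}) ∪ (frontier Ω ×ˢ Ioi 0)

/-- The data `h` on the parabolic boundary: `f` at time `0`, `g` at positive times. -/
def boundaryData {n : ℕ} (f : EuclideanSpace ℝ (Fin n) → ℝ)
    (g : EuclideanSpace ℝ (Fin n) × ℝ → ℝ) (z : EuclideanSpace ℝ (Fin n) × ℝ) : ℝ :=
  if z.2 = 0 then f z.1 else g z

/-- `u(x,t) = exp (O(t^(-s)))` as `t → ∞`, uniformly in `x ∈ Ω`. -/
def HasExpRate {n : ℕ} (Ω : Set (EuclideanSpace ℝ (Fin n)))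
    (u : EuclideanSpace ℝ (Fin n) × ℝ → ℝ) (s : ℝ) : Prop :=
  ∃ w : EuclideanSpace ℝ (Fin n) × ℝ → ℝ,
    (∀ z ∈ cylinder Ω, u z = Real.exp (w z)) ∧
      w =O[𝓟 Ω ×ˢ atTop] fun z => z.2 ^ (-s)

end Trudinger

end

namespace Trudinger

/-! ### Functions of one space coordinate and time -/

section Profile

variable {n : ℕ} (i : Fin n)

/-! Put `u = exp v`. Both terms of `Γ_p` are homogeneous of degree `p - 1` in `u` (degree 3 if `p =
∞`), so the equation becomes `Δ_p v + (p-1)|Dv|^p = (p-1) v_t`, respectively `Δ_∞ v + |Dv|^4 = 3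
v_t`, with lateral values `v = 0`. It suffices to bound `v` and `-v` from above by a decaying
barrier.

The barrier is `a(t) w(x)` with `w = 2 - δ (x_i + ρ)²`, where `ρ` is so large that `x_i + ρ ≥ 1` on
the closure of `Ω`. It depends on one coordinate, is strictly concave in it and has no critical
point. The diffusion term scales like `a^(q-1)`, where `q = p`, or `q = 4` if `p = ∞`, so `a' = -κ
a^(q-1)` with small `κ` leaves diffusion dominant. The gradient term scales like `a^q` and is
absorbed for small `δ`, because `a ≤ a 0`. The solutions of this equation (`exists_decay`) give the
stated rates.

The barrier is smooth, so no comparison principle between viscosity solutions is needed: if the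
bound fails, a bent translate of the barrier touches `± log u` inside the cylinder
(`exists_touching`), and its exponential is a test function violating the viscosity inequality
(`mul_log_le_barrier`). `exists_abs_log_le` combines both signs. -/

theorem hasFDerivAt_comp_coord {G : ℝ → ℝ} {G₁ : ℝ} {x : EuclideanSpace ℝ (Fin n)}
    (h : HasDerivAt G G₁ (x i)) :
    HasFDerivAt (fun y : EuclideanSpace ℝ (Fin n) => G (y i))
      (G₁ • (EuclideanSpace.proj i : EuclideanSpace ℝ (Fin n) →L[ℝ] ℝ)) x :=
  h.comp_hasFDerivAt x (EuclideanSpace.proj i : EuclideanSpace ℝ (Fin n) →L[ℝ] ℝ).hasFDerivAt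

theorem hasGradientAt_comp_coord {G : ℝ → ℝ} {G₁ : ℝ} {x : EuclideanSpace ℝ (Fin n)}
    (h : HasDerivAt G G₁ (x i)) :
    HasGradientAt (fun y : EuclideanSpace ℝ (Fin n) => G (y i))
      (G₁ • EuclideanSpace.single i (1 : ℝ)) x := by
  rw [hasGradientAt_iff_hasFDerivAt]
  have e : InnerProductSpace.toDual ℝ (EuclideanSpace ℝ (Fin n))
      (G₁ • EuclideanSpace.single i (1 : ℝ)) =
      G₁ • (EuclideanSpace.proj i : EuclideanSpace ℝ (Fin n) →L[ℝ] ℝ) := by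
    ext y
    have : inner ℝ (EuclideanSpace.single i (1 : ℝ)) y = y i := by
      simpa using EuclideanSpace.inner_single_left i (1 : ℝ) y
    simp [this]
  rw [e]
  exact hasFDerivAt_comp_coord i h

theorem hasFDerivAt_comp_coord_smul {G : ℝ → ℝ} {G₁ : ℝ} {x : EuclideanSpace ℝ (Fin n)}
    (h : HasDerivAt G G₁ (x i)) :
    HasFDerivAt (fun y : EuclideanSpace ℝ (Fin n) => G (y i) • EuclideanSpace.single i (1 : ℝ))
      ((G₁ • (EuclideanSpace.proj i : EuclideanSpace ℝ (Fin n) →L[ℝ] ℝ)).smulRight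
        (EuclideanSpace.single i (1 : ℝ))) x :=
  (hasFDerivAt_comp_coord i h).smul_const _

theorem gradient_comp_coord {G G₁ : ℝ → ℝ} (h : ∀ s, HasDerivAt G (G₁ s) s) :
    gradient (fun y : EuclideanSpace ℝ (Fin n) => G (y i)) =
      fun y => G₁ (y i) • EuclideanSpace.single i (1 : ℝ) :=
  funext fun _ => (hasGradientAt_comp_coord i (h _)).gradient

/-- Differentiates the one-dimensional flux `|G_s|^(p-2) G_s`. The condition `g s ≠ 0` avoids the
points where `|·|^r` need not be differentiable; it costs nothing, since the barriers have
nonvanishing spatial gradient. -/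
theorem hasDerivAt_abs_rpow_mul {g : ℝ → ℝ} {g₁ r s : ℝ} (h : HasDerivAt g g₁ s) (h0 : g s ≠ 0) :
    HasDerivAt (fun s => |g s| ^ r * g s) ((r + 1) * |g s| ^ r * g₁) s := by
  have hpos : 0 < |g s| := abs_pos.2 h0
  have habs : HasDerivAt (fun s => |g s|) (SignType.sign (g s) * g₁) s :=
    (hasDerivAt_abs h0).comp s h
  refine ((habs.rpow_const (p := r) (Or.inl hpos.ne')).mul h).congr_deriv ?_
  have e : (SignType.sign (g s) : ℝ) * g s = |g s| := sign_mul_self _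
  have e2 : |g s| ^ (r - 1) * |g s| = |g s| ^ r := by
    rw [Real.rpow_sub_one hpos.ne', div_mul_cancel₀ _ hpos.ne']
  linear_combination (r * g₁ * |g s| ^ (r - 1)) * e + r * g₁ * e2

theorem pLaplacian_comp_coord {G G₁ : ℝ → ℝ} {G₂ p : ℝ} {x : EuclideanSpace ℝ (Fin n)}
    (h : ∀ s, HasDerivAt G (G₁ s) s) (h₁ : HasDerivAt G₁ G₂ (x i)) (h0 : G₁ (x i) ≠ 0) :
    pLaplacian p (fun y => G (y i)) x = (p - 1) * |G₁ (x i)| ^ (p - 2) * G₂ := by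
  unfold pLaplacian divergence
  rw [gradient_comp_coord i h]
  have e : (fun y : EuclideanSpace ℝ (Fin n) =>
      ‖G₁ (y i) • EuclideanSpace.single i (1 : ℝ)‖ ^ (p - 2) •
        G₁ (y i) • EuclideanSpace.single i (1 : ℝ)) =
      fun y => (|G₁ (y i)| ^ (p - 2) * G₁ (y i)) • EuclideanSpace.single i (1 : ℝ) := by
    funext y
    simp [norm_smul, smul_smul]
  rw [e, (hasFDerivAt_comp_coord_smul i
    (G := fun s => |G₁ s| ^ (p - 2) * G₁ s) (hasDerivAt_abs_rpow_mul h₁ h0)).fderiv]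
  rw [Finset.sum_eq_single i]
  · simp
    left
    left
    ring
  · intro j _ hj
    simp [hj]
  · simp

theorem partialD_comp_coord {G G₁ : ℝ → ℝ} (h : ∀ s, HasDerivAt G (G₁ s) s) (j : Fin n) :
    partialD j (fun y => G (y i)) = fun y => if j = i then G₁ (y i) else 0 := by
  funext y
  unfold partialD
  rw [(hasFDerivAt_comp_coord i (h _)).fderiv]
  by_cases hj : j = i
  · simp [hj]
  · simp [hj, Ne.symm hj]

theorem inftyLaplacian_comp_coord {G G₁ G₂ : ℝ → ℝ} {x : EuclideanSpace ℝ (Fin n)}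
    (h : ∀ s, HasDerivAt G (G₁ s) s) (h₁ : ∀ s, HasDerivAt G₁ (G₂ s) s) :
    inftyLaplacian (fun y => G (y i)) x = G₁ (x i) ^ 2 * G₂ (x i) := by
  unfold inftyLaplacian
  rw [Finset.sum_eq_single i, Finset.sum_eq_single i]
  · rw [partialD_comp_coord i h]
    simp only [if_true]
    rw [partialD_comp_coord i h₁]
    simp
    left
    ring
  · intro j _ hj
    rw [partialD_comp_coord i h j]
    simp [hj]
  · simp
  · intro j _ hj
    simp [partialD_comp_coord i h j, hj]
  · simp

/-- For functions of `(x i, t)` the operator `Γ_p` is `A |G_s|^(q-2) G_ss - B c^(q-2) G_t` with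
`A = B = p - 1` and `q = p` if `p < ∞`, and with `A = 1`, `B = 3` and `q = 4` if `p = ∞`. -/
theorem gammaOp_comp_coord {p : ℝ≥0∞} {G G₁ G₂ Gt : ℝ → ℝ → ℝ}
    (h : ∀ s t, HasDerivAt (fun s => G s t) (G₁ s t) s)
    (h₁ : ∀ s t, HasDerivAt (fun s => G₁ s t) (G₂ s t) s)
    {z : EuclideanSpace ℝ (Fin n) × ℝ}
    (ht : HasDerivAt (fun t => G (z.1 i) t) (Gt (z.1 i) z.2) z.2)
    (h0 : G₁ (z.1 i) z.2 ≠ 0) (c : ℝ) :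
    gammaOp p c (fun z => G (z.1 i) z.2) z =
      (if p = ⊤ then 1 else p.toReal - 1) *
        |G₁ (z.1 i) z.2| ^ ((if p = ⊤ then 4 else p.toReal) - 2) * G₂ (z.1 i) z.2 -
      (if p = ⊤ then 3 else p.toReal - 1) * c ^ ((if p = ⊤ then 4 else p.toReal) - 2) *
        Gt (z.1 i) z.2 := by
  have e : timeD (fun z : EuclideanSpace ℝ (Fin n) × ℝ => G (z.1 i) z.2) z = Gt (z.1 i) z.2 :=
    ht.deriv
  unfold gammaOp
  rw [e]
  by_cases hp : p = ⊤
  · simp only [hp, if_true]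
    rw [inftyLaplacian_comp_coord i (fun s => h s z.2) (fun s => h₁ s z.2)]
    norm_num
  · simp only [hp, if_false]
    rw [pLaplacian_comp_coord i (fun s => h s z.2) (h₁ _ z.2) h0]

/-- Time regularity is asked only for `t > 0`, because the time factor of the barrier is controlled
only for nonnegative times. -/
theorem isTestFunction_comp_coord {Ω : Set (EuclideanSpace ℝ (Fin n))} {G G₁ G₂ Gt : ℝ → ℝ → ℝ}
    (h : ∀ s t, HasDerivAt (fun s => G s t) (G₁ s t) s)
    (h₁ : ∀ s t, HasDerivAt (fun s => G₁ s t) (G₂ s t) s)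
    (ht : ∀ s, ∀ t > 0, HasDerivAt (fun t => G s t) (Gt s t) t)
    (hG : ∀ t, ContDiff ℝ 2 (fun s => G s t))
    (hc : ContinuousOn (fun z : ℝ × ℝ => G z.1 z.2) (univ ×ˢ Ioi 0))
    (hc₁ : ContinuousOn (fun z : ℝ × ℝ => G₁ z.1 z.2) (univ ×ˢ Ioi 0))
    (hc₂ : ContinuousOn (fun z : ℝ × ℝ => G₂ z.1 z.2) (univ ×ˢ Ioi 0))
    (hct : ContinuousOn (fun z : ℝ × ℝ => Gt z.1 z.2) (univ ×ˢ Ioi 0)) :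
    IsTestFunction (cylinder Ω) (fun z => G (z.1 i) z.2) := by
  have hπ : ContinuousOn (fun z : EuclideanSpace ℝ (Fin n) × ℝ => (z.1 i, z.2)) (cylinder Ω) := by
    fun_prop
  have hm : MapsTo (fun z : EuclideanSpace ℝ (Fin n) × ℝ => (z.1 i, z.2)) (cylinder Ω)
      (univ ×ˢ Ioi 0) := fun z hz => ⟨mem_univ _, hz.2⟩
  have eg : spaceGrad (fun z : EuclideanSpace ℝ (Fin n) × ℝ => G (z.1 i) z.2) =
      fun z => G₁ (z.1 i) z.2 • EuclideanSpace.single i (1 : ℝ) :=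
    funext fun z => (hasGradientAt_comp_coord i (h _ z.2)).gradient
  refine ⟨fun z _ => ?_, fun z hz => (ht (z.1 i) _ hz.2).differentiableAt, hc.comp hπ hm, ?_, ?_, ?_⟩
  · exact ((hG z.2).comp (g := fun s => G s z.2)
      (EuclideanSpace.proj i : EuclideanSpace ℝ (Fin n) →L[ℝ] ℝ).contDiff).contDiffAt
  · rw [eg]
    exact (hc₁.comp hπ hm).smul continuousOn_const
  · have eh : spaceHess (fun z : EuclideanSpace ℝ (Fin n) × ℝ => G (z.1 i) z.2) =
        fun z => G₂ (z.1 i) z.2 •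
          (EuclideanSpace.proj i : EuclideanSpace ℝ (Fin n) →L[ℝ] ℝ).smulRight
            (EuclideanSpace.single i (1 : ℝ)) := by
      funext z
      unfold spaceHess
      rw [eg, (hasFDerivAt_comp_coord_smul i (h₁ _ z.2)).fderiv]
      ext y
      simp
    rw [eh]
    exact (hc₂.comp hπ hm).smul continuousOn_const
  · exact (hct.comp hπ hm).congr fun z hz => (ht (z.1 i) _ hz.2).deriv

end Profile

/-! ### Decay of the time factor -/

/-- The equation separates: the solution is `a₀ exp(-κ t)` if `q = 2`, and `(a₀^(-(q-2)) + κ (q-2)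
t)^(-1/(q-2))` if `q > 2`. Dropping the positive constant in the second base gives the power rate.
-/
theorem exists_decay {q κ a₀ : ℝ} (hq : 2 ≤ q) (hκ : 0 < κ) (ha₀ : 0 < a₀) :
    ∃ a : ℝ → ℝ, a 0 = a₀ ∧ (∀ t, 0 ≤ t → 0 < a t ∧ a t ≤ a₀) ∧
      (∀ t, 0 ≤ t → HasDerivAt a (-κ * a t ^ (q - 1)) t) ∧
      (q = 2 → ∀ s : ℝ, a =O[atTop] fun t => t ^ (-s)) ∧
      (2 < q → a =O[atTop] fun t => t ^ (-(1 / (q - 2)))) := by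
  rcases hq.eq_or_lt with rfl | hq
  · refine ⟨fun t => a₀ * Real.exp (-κ * t), by simp, fun t ht => ⟨by positivity, ?_⟩, ?_, ?_,
      fun h => absurd h (lt_irrefl _)⟩
    · refine mul_le_of_le_one_right ha₀.le (Real.exp_le_one_iff.2 ?_)
      nlinarith
    · intro t _
      have := (((hasDerivAt_id t).const_mul (-κ)).exp).const_mul a₀
      refine this.congr_deriv ?_
      norm_num
      ring
    · intro _ s
      exact ((isLittleO_exp_neg_mul_rpow_atTop hκ (-s)).isBigO).const_mul_left a₀
  · set r := q - 2 with hr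
    have hr0 : 0 < r := by linarith
    set b := a₀ ^ (-r) with hb
    have hb0 : 0 < b := Real.rpow_pos_of_pos ha₀ _
    have hbase : ∀ t, 0 ≤ t → 0 < b + κ * r * t := fun t ht => by positivity
    have ha0 : b ^ (-(1 / r)) = a₀ := by
      rw [hb, ← Real.rpow_mul ha₀.le]
      have : -r * -(1 / r) = 1 := by field_simp
      rw [this, Real.rpow_one]
    refine ⟨fun t => (b + κ * r * t) ^ (-(1 / r)), by simpa using ha0, fun t ht =>
      ⟨Real.rpow_pos_of_pos (hbase t ht) _, ?_⟩, ?_, fun h => absurd h.symm hq.ne, fun _ => ?_⟩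
    · conv_rhs => rw [← ha0]
      refine Real.rpow_le_rpow_of_nonpos hb0 ?_ (by have := one_div_pos.2 hr0; linarith)
      have : 0 ≤ κ * r * t := by positivity
      linarith
    · intro t ht
      have h1 : HasDerivAt (fun t => b + κ * r * t) (κ * r) t := by
        simpa using ((hasDerivAt_id t).const_mul (κ * r)).const_add b
      refine (h1.rpow_const (p := -(1 / r)) (Or.inl (hbase t ht).ne')).congr_deriv ?_
      rw [← Real.rpow_mul (hbase t ht).le]
      have : -(1 / r) * (q - 1) = -(1 / r) - 1 := by
        have : q - 1 = r + 1 := by rw [hr]; ring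
        rw [this]
        field_simp
        ring
      rw [this]
      field_simp
    · refine IsBigO.of_bound ((κ * r) ^ (-(1 / r))) ?_
      filter_upwards [eventually_gt_atTop 0] with t ht
      have hk : 0 < κ * r := by positivity
      rw [Real.norm_of_nonneg (Real.rpow_nonneg (hbase t ht.le).le _),
        Real.norm_of_nonneg (Real.rpow_nonneg ht.le _), ← Real.mul_rpow hk.le ht.le]
      exact Real.rpow_le_rpow_of_nonpos (by positivity) (by linarith)
        (by have := one_div_pos.2 hr0; linarith)

end Trudinger

namespace Trudinger

/-! ### Comparison with barriers -/

/-- If `L ≤ b` on the parabolic boundary but not in the cylinder, then a translate of `b`, bent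
upwards for late times, touches `L` from above at a point of the cylinder. -/
theorem exists_touching {n : ℕ} {Ω : Set (EuclideanSpace ℝ (Fin n))} (hΩ : IsOpen Ω)
    (hbd : Bornology.IsBounded Ω) {L b : EuclideanSpace ℝ (Fin n) × ℝ → ℝ}
    (hL : ContinuousOn L (closure Ω ×ˢ Ici 0)) (hb : ContinuousOn b (closure Ω ×ˢ Ici 0))
    (h0 : ∀ x ∈ closure Ω, L (x, 0) ≤ b (x, 0))
    (hlat : ∀ x ∈ frontier Ω, ∀ t, 0 ≤ t → L (x, t) ≤ b (x, t))
    {z₁ : EuclideanSpace ℝ (Fin n) × ℝ} (hz₁ : z₁ ∈ cylinder Ω) (hlt : b z₁ < L z₁) :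
    ∃ T A m : ℝ, 0 ≤ A ∧ ∃ z ∈ cylinder Ω,
      (∀ᶠ y in 𝓝 z, L y ≤ b y + A * max (y.2 - T) 0 ^ 2 + m) ∧
        L z = b z + A * max (z.2 - T) 0 ^ 2 + m := by
  have hz₁t : 0 < z₁.2 := hz₁.2
  set T := z₁.2 with hT
  set K := closure Ω ×ˢ Icc (0 : ℝ) (T + 1) with hK
  have hKc : IsCompact K := hbd.isCompact_closure.prod isCompact_Icc
  have hKs : K ⊆ closure Ω ×ˢ Ici 0 := fun z hz => ⟨hz.1, hz.2.1⟩
  have hz₁K : z₁ ∈ K := ⟨subset_closure hz₁.1, hz₁t.le, by linarith⟩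
  have hD : ContinuousOn (fun z => L z - b z) K := (hL.mono hKs).sub (hb.mono hKs)
  obtain ⟨C, hC⟩ := (hKc.image_of_continuousOn hD).bddAbove
  -- `C` bounds `L - b` on `K`, and the penalty `A * max (t - T) 0 ^ 2` equals `A` at `t = T + 1`.
  -- Hence the penalized difference is nonpositive on the top face, while at `z₁`, where the penalty
  -- vanishes, it is positive: the maximum is interior in time.
  set A := max C 0 with hA
  have hA0 : 0 ≤ A := le_max_right _ _
  have hF : ContinuousOn (fun z : EuclideanSpace ℝ (Fin n) × ℝ =>
      L z - b z - A * max (z.2 - T) 0 ^ 2) K := hD.sub (by fun_prop)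
  obtain ⟨z, hzK, hz⟩ := hKc.exists_isMaxOn ⟨z₁, hz₁K⟩ hF
  have hpos : 0 < L z - b z - A * max (z.2 - T) 0 ^ 2 := by
    have h := hz hz₁K
    simp only [mem_ofPred_eq, ← hT, sub_self, max_self] at h
    nlinarith
  have hsq : 0 ≤ A * max (z.2 - T) 0 ^ 2 := by positivity
  obtain ⟨x, t⟩ := z
  have ht0 : 0 < t := by
    rcases hzK.2.1.eq_or_lt with h | h
    · simp only at h
      subst h
      have := h0 x hzK.1
      linarith
    · exact h
  have hxΩ : x ∈ Ω := by
    by_contra hx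
    have hxf : x ∈ frontier Ω := by
      rw [hΩ.frontier_eq]
      exact ⟨hzK.1, hx⟩
    have := hlat x hxf t ht0.le
    linarith
  have htT : t < T + 1 := by
    rcases hzK.2.2.eq_or_lt with h | h
    · simp only at h
      have h1 : L (x, t) - b (x, t) ≤ A := (hC ⟨_, hzK, rfl⟩).trans (le_max_left _ _)
      have h2 : max (t - T) 0 = 1 := by rw [h]; simp
      simp only [h2] at hpos
      linarith
    · exact h
  refine ⟨T, A, L (x, t) - b (x, t) - A * max (t - T) 0 ^ 2, hA0, (x, t), ⟨hxΩ, ht0⟩, ?_, by ring⟩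
  have hnhds : Ω ×ˢ Ioo 0 (T + 1) ∈ 𝓝 (x, t) :=
    (hΩ.prod isOpen_Ioo).mem_nhds ⟨hxΩ, ht0, htT⟩
  filter_upwards [hnhds] with y hy
  have h := hz (show y ∈ K from ⟨subset_closure hy.1, hy.2.1.le, hy.2.2.le⟩)
  simp only [mem_ofPred_eq] at h
  linarith

/-- The square makes the late-time penalty `C¹` across `t = T`, as a test function requires; its
derivative is nonnegative, which is the harmless sign for an upper barrier. -/
theorem hasDerivAt_max_zero_sq (T t : ℝ) :
    HasDerivAt (fun t => max (t - T) 0 ^ 2) (2 * max (t - T) 0) t := by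
  rcases lt_trichotomy t T with h | rfl | h
  · rw [max_eq_right (by linarith), mul_zero]
    refine (hasDerivAt_const t (0 : ℝ)).congr_of_eventuallyEq ?_
    filter_upwards [Iio_mem_nhds h] with s hs
    rw [max_eq_right (by linarith [mem_Iio.1 hs])]
    norm_num
  · rw [sub_self, max_self, mul_zero, hasDerivAt_iff_isLittleO]
    simp only [sub_self, max_self, smul_zero, sub_zero, ne_eq, OfNat.ofNat_ne_zero,
      not_false_eq_true, zero_pow]
    refine IsBigO.trans_isLittleO (g := fun s => (s - t) ^ 2) ?_ ?_
    · refine IsBigO.of_bound 1 (Eventually.of_forall fun s => ?_)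
      rw [one_mul, norm_pow, norm_pow]
      gcongr
      rw [Real.norm_of_nonneg (le_max_right _ _), Real.norm_eq_abs]
      exact max_le (le_abs_self _) (abs_nonneg _)
    · simpa only [Real.norm_eq_abs, sq_abs] using isLittleO_pow_sub_sub t one_lt_two
  · rw [max_eq_left (by linarith)]
    have h1 : HasDerivAt (fun s => (s - T) ^ 2) (2 * (t - T)) t := by
      exact (((hasDerivAt_id t).sub_const T).pow 2).congr_deriv (by simp)
    refine h1.congr_of_eventuallyEq ?_
    filter_upwards [Ioi_mem_nhds h] with s hs
    rw [max_eq_left (by linarith [mem_Ioi.1 hs])]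

/-- One-sided bound for `log u` (`σ = 1`) or `-log u` (`σ = -1`) by the barrier
`a(t) (2 - δ (x_i + ρ)²)`. -/
theorem mul_log_le_barrier {n : ℕ} (i : Fin n) {p : ℝ≥0∞} {q A B σ ρ δ κ a₀ N : ℝ}
    (hqdef : q = if p = ⊤ then 4 else p.toReal) (hAdef : A = if p = ⊤ then 1 else p.toReal - 1)
    (hBdef : B = if p = ⊤ then 3 else p.toReal - 1)
    (hq : 2 ≤ q) (hA : 0 < A) (hB : 0 < B) (hσ : σ ^ 2 = 1)
    {Ω : Set (EuclideanSpace ℝ (Fin n))} (hΩ : IsOpen Ω) (hbd : Bornology.IsBounded Ω)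
    (hρ : ∀ x ∈ closure Ω, 1 ≤ x i + ρ ∧ x i + ρ ≤ N)
    (hδ : 0 < δ) (hδ₁ : δ * N ^ 2 ≤ 1) (hδ₂ : 4 * a₀ * δ * N ^ 2 ≤ 1)
    (hκ : κ = A * δ * (2 * δ) ^ (q - 2) / (4 * B))
    {a : ℝ → ℝ} (ha0 : a 0 = a₀) (ha : ∀ t, 0 ≤ t → 0 < a t ∧ a t ≤ a₀)
    (ha' : ∀ t, 0 ≤ t → HasDerivAt a (-κ * a t ^ (q - 1)) t)
    {u : EuclideanSpace ℝ (Fin n) × ℝ → ℝ} (hu : ContinuousOn u (closure Ω ×ˢ Ici 0))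
    (hpos : ∀ z ∈ closure Ω ×ˢ Ici (0 : ℝ), 0 < u z)
    (htest : ∀ ψ, IsTestFunction (cylinder Ω) ψ → ∀ z ∈ cylinder Ω,
      (∀ᶠ y in 𝓝 z, σ * u y ≤ σ * ψ y) → u z = ψ z → 0 ≤ σ * gammaOp p (u z) ψ z)
    (hinit : ∀ x ∈ closure Ω, σ * Real.log (u (x, 0)) ≤ a₀)
    (hlat : ∀ x ∈ frontier Ω, ∀ t : ℝ, 0 ≤ t → u (x, t) = 1) :
    ∀ z ∈ cylinder Ω, σ * Real.log (u z) ≤ a z.2 * (2 - δ * (z.1 i + ρ) ^ 2) := by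
  have hacont : ContinuousOn a (Ici 0) := fun t ht => (ha' t ht).continuousAt.continuousWithinAt
  -- The spatial factor is at least 1, so the barrier dominates `a₀` at time 0 and is positive on
  -- the lateral boundary, where `log u = 0`.
  have hw : ∀ x ∈ closure Ω, 1 ≤ 2 - δ * (x i + ρ) ^ 2 := by
    intro x hx
    obtain ⟨h1, h2⟩ := hρ x hx
    have : (x i + ρ) ^ 2 ≤ N ^ 2 := by gcongr
    nlinarith
  by_contra! hcon
  obtain ⟨z₁, hz₁, hlt⟩ := hcon
  obtain ⟨T, E, m, hE, z, hz, hev, heq⟩ := exists_touching (L := fun z => σ * Real.log (u z))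
    (b := fun z => a z.2 * (2 - δ * (z.1 i + ρ) ^ 2)) hΩ hbd
    (continuousOn_const.mul (hu.log fun z hz => (hpos z hz).ne'))
    ((hacont.comp continuousOn_snd fun z hz => hz.2).mul (by fun_prop))
    (fun x hx => by
      have h1 := hinit x hx
      have h2 := hw x hx
      have h3 := (ha 0 le_rfl).1
      simp only [ha0] at h3 ⊢
      nlinarith)
    (fun x hx t ht => by
      have h2 := hw x (frontier_subset_closure hx)
      have h3 := (ha t ht).1
      simp only [hlat x hx t ht, Real.log_one, mul_zero]
      positivity) hz₁ hlt
  have hzt : 0 < z.2 := hz.2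
  -- the touching function and its derivatives
  set V : ℝ → ℝ → ℝ := fun s t =>
    a t * (2 - δ * (s + ρ) ^ 2) + E * max (t - T) 0 ^ 2 + m with hV
  -- Since `σ² = 1`, exponentiating `σ V` returns to the scale of `u`: `G` touches `u` from above if
  -- `σ = 1` and from below if `σ = -1`.
  set G : ℝ → ℝ → ℝ := fun s t => Real.exp (σ * V s t) with hG
  set G₁ : ℝ → ℝ → ℝ := fun s t => G s t * (σ * (a t * (-(2 * δ * (s + ρ))))) with hG₁
  set G₂ : ℝ → ℝ → ℝ := fun s t =>
    G s t * (σ * (a t * (-(2 * δ)))) + G s t * (a t * (2 * δ * (s + ρ))) ^ 2 with hG₂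
  set Gt : ℝ → ℝ → ℝ := fun s t => G s t * (σ * (-κ * a t ^ (q - 1) * (2 - δ * (s + ρ) ^ 2) +
    E * (2 * max (t - T) 0))) with hGt
  have hVs : ∀ s t, HasDerivAt (fun s => V s t) (a t * (-(2 * δ * (s + ρ)))) s := by
    intro s t
    have h1 : HasDerivAt (fun s => (s + ρ) ^ 2) (2 * (s + ρ)) s := by
      exact (((hasDerivAt_id s).add_const ρ).pow 2).congr_deriv (by simp)
    refine (((((h1.const_mul δ).const_sub 2).const_mul (a t)).add_const _).add_const m).congr_deriv
      ?_
    ring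
  have h₁ : ∀ s t, HasDerivAt (fun s => G s t) (G₁ s t) s := fun s t =>
    ((hVs s t).const_mul σ).exp
  have h₂ : ∀ s t, HasDerivAt (fun s => G₁ s t) (G₂ s t) s := by
    intro s t
    have h3 : HasDerivAt (fun s => σ * (a t * (-(2 * δ * (s + ρ))))) (σ * (a t * (-(2 * δ)))) s := by
      have := (((((hasDerivAt_id s).add_const ρ).const_mul (2 * δ)).neg).const_mul (a t)).const_mul σ
      refine this.congr_deriv ?_
      ring
    refine ((h₁ s t).mul h3).congr_deriv ?_
    simp only [hG₁, hG₂]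
    linear_combination (G s t * (a t * (2 * δ * (s + ρ))) ^ 2) * hσ
  have hTt : ∀ s, ∀ t > 0, HasDerivAt (fun t => G s t) (Gt s t) t := by
    intro s t ht
    exact (((((ha' t ht.le).mul_const _).add
      ((hasDerivAt_max_zero_sq T t).const_mul E)).add_const m).const_mul σ).exp
  have hac : ContinuousOn (fun z : ℝ × ℝ => a z.2) (univ ×ˢ Ioi 0) :=
    hacont.comp continuousOn_snd fun z hz => mem_Ici.2 (le_of_lt hz.2)
  have hcV : ContinuousOn (fun z : ℝ × ℝ => V z.1 z.2) (univ ×ˢ Ioi 0) := by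
    exact ((hac.mul (by fun_prop)).add (by fun_prop)).add continuousOn_const
  have hcG : ContinuousOn (fun z : ℝ × ℝ => G z.1 z.2) (univ ×ˢ Ioi 0) := by
    simp only [hG]
    fun_prop
  have hcp : ContinuousOn (fun z : ℝ × ℝ => a z.2 ^ (q - 1)) (univ ×ˢ Ioi 0) :=
    hac.rpow_const fun z _ => Or.inr (by linarith)
  have htf : IsTestFunction (cylinder Ω)
      (fun z : EuclideanSpace ℝ (Fin n) × ℝ => G (z.1 i) z.2) := by
    refine isTestFunction_comp_coord i h₁ h₂ hTt (fun t => ?_) hcG ?_ ?_ ?_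
    · simp only [hG, hV]
      fun_prop
    · exact hcG.mul (continuousOn_const.mul (hac.mul (by fun_prop)))
    · exact (hcG.mul (continuousOn_const.mul (hac.mul continuousOn_const))).add
        (hcG.mul ((hac.mul (by fun_prop)).pow 2))
    · exact hcG.mul (continuousOn_const.mul
        (((continuousOn_const.mul hcp).mul (by fun_prop)).add (by fun_prop)))
  obtain ⟨hy1, hyN⟩ := hρ z.1 (subset_closure hz.1)
  obtain ⟨hat, hata⟩ := ha z.2 hzt.le
  have hw1 : 2 - δ * (z.1 i + ρ) ^ 2 ≤ 2 := by nlinarith [sq_nonneg (z.1 i + ρ)]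
  have hσ0 : σ ≠ 0 := by
    rintro rfl
    norm_num at hσ
  have hσabs : |σ| = 1 := by
    rw [← sq_eq_sq₀ (abs_nonneg _) zero_le_one, sq_abs, hσ, one_pow]
  have hGpos : 0 < G (z.1 i) z.2 := Real.exp_pos _
  have hne : G₁ (z.1 i) z.2 ≠ 0 := by
    simp only [hG₁]
    have : 0 < 2 * δ * (z.1 i + ρ) := by positivity
    exact mul_ne_zero hGpos.ne' (mul_ne_zero hσ0 (mul_ne_zero hat.ne' (neg_ne_zero.2 this.ne')))
  have hueq : ∀ y, 0 < u y → u y = Real.exp (σ * (σ * Real.log (u y))) := by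
    intro y hy
    rw [← mul_assoc, ← sq, hσ, one_mul, Real.exp_log hy]
  have huz : u z = G (z.1 i) z.2 := by
    rw [hueq z (hpos z ⟨subset_closure hz.1, hzt.le⟩)]
    simp only at heq
    rw [heq]
  have hcyl : cylinder Ω ∈ 𝓝 z := (hΩ.prod isOpen_Ioi).mem_nhds hz
  have key := htest _ htf z hz ?_ huz
  · rw [gammaOp_comp_coord i h₁ h₂ (hTt _ _ hzt) hne, ← hqdef, ← hAdef, ← hBdef, huz] at key
    set g := G (z.1 i) z.2 with hg
    set Y := z.1 i + ρ with hY
    set α := a z.2 with hα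
    have hY0 : 0 < Y := by linarith
    have e1 : |G₁ (z.1 i) z.2| = g * (α * (2 * δ * Y)) := by
      simp only [hG₁]
      rw [abs_mul, abs_mul, abs_mul, abs_neg, hσabs, one_mul, abs_of_pos hGpos, abs_of_pos hat,
        abs_of_pos (by positivity)]
    have e2 : |G₁ (z.1 i) z.2| ^ (q - 2) =
        g ^ (q - 2) * (α ^ (q - 2) * ((2 * δ) ^ (q - 2) * Y ^ (q - 2))) := by
      rw [e1, Real.mul_rpow hGpos.le (by positivity), Real.mul_rpow hat.le (by positivity),
        Real.mul_rpow (by positivity) hY0.le]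
    have e3 : α ^ (q - 1) = α ^ (q - 2) * α := by
      rw [← Real.rpow_add_one hat.ne']
      congr 1
      ring
    have hYp : 1 ≤ Y ^ (q - 2) := Real.one_le_rpow hy1 (by linarith)
    rw [e2] at key
    simp only [hG₂, hGt, ← hg, ← hY, ← hα] at key
    rw [e3] at key
    set P := g ^ (q - 2) with hP
    set Q := α ^ (q - 2) with hQ
    set D := (2 * δ) ^ (q - 2) with hDdef
    set W := Y ^ (q - 2) with hWdef
    have hP0 : 0 < P := Real.rpow_pos_of_pos hGpos _
    have hQ0 : 0 < Q := Real.rpow_pos_of_pos hat _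
    have hD0 : 0 < D := Real.rpow_pos_of_pos (by positivity) _
    -- The factor `P * g = g^(q-1)` comes out by homogeneity, leaving `A |V_s|^(q-2) (V_ss + σ V_s²)
    -- - B V_t` for the logarithm.
    have hkey : 0 ≤ P * g * (A * (Q * (D * W)) * (α * (-(2 * δ)) + σ * (α * (2 * δ * Y)) ^ 2) -
        B * (-κ * (Q * α) * (2 - δ * Y ^ 2) + E * (2 * max (z.2 - T) 0))) := by
      refine key.trans_eq ?_
      linear_combination (-(P * g * A * Q * D * W * α * (2 * δ)) -
        P * g * B * (-κ * (Q * α) * (2 - δ * Y ^ 2) + E * (2 * max (z.2 - T) 0))) * hσ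
    have hbr := nonneg_of_mul_nonneg_right hkey (mul_pos hP0 hGpos)
    have hY2 : Y ^ 2 ≤ N ^ 2 := by gcongr
    have h4 : 4 * α * δ * Y ^ 2 ≤ 1 := by
      refine le_trans ?_ hδ₂
      have : 0 ≤ a₀ := hat.le.trans hata
      gcongr
    have hσle : σ ≤ 1 := hσabs ▸ le_abs_self σ
    -- By `4 a₀ δ N² ≤ 1` the gradient term uses up at most half of `V_ss = -2αδ`. Only `σ ≤ 1`
    -- matters, so both signs are covered.
    have hin : α * (-(2 * δ)) + σ * (α * (2 * δ * Y)) ^ 2 ≤ -(α * δ) := by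
      have h5 : σ * (α * (2 * δ * Y)) ^ 2 ≤ 1 * (α * (2 * δ * Y)) ^ 2 := by gcongr
      have h6 : (α * (2 * δ * Y)) ^ 2 = α * δ * (4 * α * δ * Y ^ 2) := by ring
      have h7 : α * δ * (4 * α * δ * Y ^ 2) ≤ α * δ * 1 := by gcongr
      linarith
    have h8 : A * (Q * (D * W)) * (α * (-(2 * δ)) + σ * (α * (2 * δ * Y)) ^ 2) ≤
        -(A * Q * D * α * δ) := by
      have h9 : A * (Q * (D * 1)) * (α * δ) ≤ A * (Q * (D * W)) * (α * δ) := by gcongr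
      have h10 := mul_le_mul_of_nonneg_left hin (show 0 ≤ A * (Q * (D * W)) by positivity)
      linarith
    have hκ0 : 0 < κ := by rw [hκ]; positivity
    have h11 : κ * (Q * α) * (2 - δ * Y ^ 2) ≤ κ * (Q * α) * 2 := by gcongr
    have h12 : 0 ≤ E * (2 * max (z.2 - T) 0) := by positivity
    -- With this `κ` the decay of `a` costs at most half of the remaining diffusion `A Q D α δ`, and
    -- the penalty only helps; the sum is strictly negative, a contradiction.
    have h13 : B * κ * 4 = A * δ * D := by
      rw [hκ]
      field_simp
    have h14 : 0 < A * Q * D * α * δ := by positivity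
    have h15 := mul_le_mul_of_nonneg_left h11 hB.le
    have h16 := mul_nonneg hB.le h12
    have h17 : B * (κ * (Q * α) * 2) = A * Q * D * α * δ / 2 := by
      linear_combination (Q * α / 2) * h13
    linarith
  · filter_upwards [hev, hcyl] with y hy hyc
    have hyp := hpos y ⟨subset_closure hyc.1, mem_Ici.2 (le_of_lt hyc.2)⟩
    have hyV : σ * Real.log (u y) ≤ V (y.1 i) y.2 := hy
    have hyu := hueq y hyp
    rcases eq_or_eq_neg_of_sq_eq_sq σ 1 (by rw [hσ, one_pow]) with rfl | rfl
    · rw [one_mul, one_mul, hyu]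
      exact Real.exp_le_exp.2 (by linarith)
    · have : G (y.1 i) y.2 ≤ u y := by
        rw [hyu]
        exact Real.exp_le_exp.2 (by linarith)
      linarith

end Trudinger

namespace Trudinger

/-! ### Convergence to the lateral boundary value -/

theorem closure_prod_Ici_subset {n : ℕ} {Ω : Set (EuclideanSpace ℝ (Fin n))} (hΩ : IsOpen Ω) :
    closure Ω ×ˢ Ici (0 : ℝ) ⊆ cylinder Ω ∪ parabolicBoundary Ω := by
  rintro ⟨x, t⟩ ⟨hx, ht⟩
  rcases (mem_Ici.1 ht).eq_or_lt with h | h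
  · exact Or.inr (Or.inl ⟨hx, h.symm⟩)
  · by_cases hxΩ : x ∈ Ω
    · exact Or.inl ⟨hxΩ, h⟩
    · refine Or.inr (Or.inr ⟨?_, h⟩)
      rw [hΩ.frontier_eq]
      exact ⟨hx, hxΩ⟩

/-- With lateral boundary values `1` and initial values between positive constants, `|log u|` is
bounded by a function of time decaying at the rate of the ordinary differential equation
`a' = -κ a^(q-1)`, where `q = p` if `p < ∞` and `q = 4` if `p = ∞`. -/
theorem exists_abs_log_le {n : ℕ} (i : Fin n) {p : ℝ≥0∞} (hp : 2 ≤ p)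
    {Ω : Set (EuclideanSpace ℝ (Fin n))} (hΩ : IsOpen Ω) (hbd : Bornology.IsBounded Ω)
    {u : EuclideanSpace ℝ (Fin n) × ℝ → ℝ} (hu : ContinuousOn u (closure Ω ×ˢ Ici 0))
    (hpos : ∀ z ∈ closure Ω ×ˢ Ici (0 : ℝ), 0 < u z)
    (hsol : IsViscositySolution p (cylinder Ω) u)
    {a₀ : ℝ} (ha₀ : 0 < a₀) (hinit : ∀ x ∈ closure Ω, |Real.log (u (x, 0))| ≤ a₀)
    (hlat : ∀ x ∈ frontier Ω, ∀ t : ℝ, 0 ≤ t → u (x, t) = 1) :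
    ∃ a : ℝ → ℝ, (∀ z ∈ cylinder Ω, |Real.log (u z)| ≤ 2 * a z.2) ∧
      (p = 2 → ∀ s : ℝ, a =O[atTop] fun t => t ^ (-s)) ∧
      (2 < p → p < ⊤ → a =O[atTop] fun t => t ^ (-(1 / (p.toReal - 2)))) ∧
      (p = ⊤ → a =O[atTop] fun t => t ^ (-(1 / 2 : ℝ))) := by
  obtain ⟨q, hqdef⟩ : ∃ q : ℝ, q = if p = ⊤ then 4 else p.toReal := ⟨_, rfl⟩
  obtain ⟨A, hAdef⟩ : ∃ A : ℝ, A = if p = ⊤ then 1 else p.toReal - 1 := ⟨_, rfl⟩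
  obtain ⟨B, hBdef⟩ : ∃ B : ℝ, B = if p = ⊤ then 3 else p.toReal - 1 := ⟨_, rfl⟩
  have hreal : p ≠ ⊤ → 2 ≤ p.toReal := fun h => by
    simpa using ENNReal.toReal_mono h hp
  obtain ⟨hq, hA, hB⟩ : 2 ≤ q ∧ 0 < A ∧ 0 < B := by
    by_cases h : p = ⊤
    · simp only [h, if_true] at hqdef hAdef hBdef
      subst hqdef hAdef hBdef
      norm_num
    · simp only [h, if_false] at hqdef hAdef hBdef
      have := hreal h
      exact ⟨by linarith, by linarith, by linarith⟩
  obtain ⟨R, hR, hRb⟩ := hbd.closure.exists_pos_norm_le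
  set N := 2 * R + 1 with hN
  have hN0 : 0 < N := by positivity
  -- Chosen so that the two quantities required to be at most 1 in `mul_log_le_barrier` add up to
  -- exactly 1. The shift `R + 1` places `x i + (R + 1)` in `[1, N]`.
  obtain ⟨δ, hδdef⟩ : ∃ δ, δ = 1 / ((1 + 4 * a₀) * N ^ 2) := ⟨_, rfl⟩
  have hδ : 0 < δ := by rw [hδdef]; positivity
  have hδN : δ * N ^ 2 + 4 * a₀ * δ * N ^ 2 = 1 := by
    rw [hδdef]
    field_simp
  have hρ : ∀ x ∈ closure Ω, 1 ≤ x i + (R + 1) ∧ x i + (R + 1) ≤ N := by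
    intro x hx
    have h := abs_le.1 ((PiLp.norm_apply_le x i).trans (hRb x hx))
    constructor <;> linarith [h.1, h.2]
  obtain ⟨κ, hκ⟩ : ∃ κ, κ = A * δ * (2 * δ) ^ (q - 2) / (4 * B) := ⟨_, rfl⟩
  have hκ0 : 0 < κ := by rw [hκ]; positivity
  obtain ⟨a, ha0, ha, ha', hrate₂, hrate⟩ := exists_decay hq hκ0 ha₀
  have hδ₁ : δ * N ^ 2 ≤ 1 := by
    have : 0 ≤ 4 * a₀ * δ * N ^ 2 := by positivity
    linarith
  have hδ₂ : 4 * a₀ * δ * N ^ 2 ≤ 1 := by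
    have : 0 ≤ δ * N ^ 2 := by positivity
    linarith
  refine ⟨a, fun z hz => ?_, fun h => hrate₂ ?_, fun h h' => ?_, fun h => ?_⟩
  · have hup := mul_log_le_barrier (σ := 1) i hqdef hAdef hBdef hq hA hB (by norm_num) hΩ hbd hρ
      hδ hδ₁ hδ₂ hκ ha0 ha ha' hu hpos
      (fun ψ hψ z hz hev heq => by
        rw [one_mul]
        refine hsol.sub.test ψ hψ z hz ?_
        filter_upwards [hev] with y hy
        rw [heq]
        linarith)
      (fun x hx => by linarith [le_abs_self (Real.log (u (x, 0))), hinit x hx]) hlat z hz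
    have hlow := mul_log_le_barrier (σ := -1) i hqdef hAdef hBdef hq hA hB (by norm_num) hΩ hbd hρ
      hδ hδ₁ hδ₂ hκ ha0 ha ha' hu hpos
      (fun ψ hψ z hz hev heq => by
        have : gammaOp p (u z) ψ z ≤ 0 := by
          refine hsol.super.test ψ hψ z hz ?_
          filter_upwards [hev] with y hy
          rw [heq]
          linarith
        linarith)
      (fun x hx => by linarith [neg_abs_le (Real.log (u (x, 0))), hinit x hx]) hlat z hz
    have hle : a z.2 * (2 - δ * (z.1 i + (R + 1)) ^ 2) ≤ 2 * a z.2 := by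
      have : 0 ≤ a z.2 * (δ * (z.1 i + (R + 1)) ^ 2) :=
        mul_nonneg (ha z.2 (le_of_lt hz.2)).1.le (by positivity)
      linarith
    exact abs_le.2 ⟨by linarith, by linarith⟩
  · rw [hqdef, h]
    simp
  · have hqp : q = p.toReal := by rw [hqdef, if_neg h'.ne]
    rw [← hqp]
    refine hrate ?_
    rw [hqp]
    simpa using (ENNReal.toReal_lt_toReal (by simp) h'.ne).2 h
  · have hq4 : q = 4 := by rw [hqdef, if_pos h]
    have := hrate (by rw [hq4]; norm_num)
    rw [hq4] at this
    norm_num at this ⊢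
    exact this

theorem HasExpRate.of_abs_log_le {n : ℕ} {Ω : Set (EuclideanSpace ℝ (Fin n))}
    {u : EuclideanSpace ℝ (Fin n) × ℝ → ℝ} {a : ℝ → ℝ} {s : ℝ}
    (hpos : ∀ z ∈ cylinder Ω, 0 < u z) (hle : ∀ z ∈ cylinder Ω, |Real.log (u z)| ≤ 2 * a z.2)
    (ha : a =O[atTop] fun t => t ^ (-s)) : HasExpRate Ω u s := by
  refine ⟨fun z => Real.log (u z), fun z hz => (Real.exp_log (hpos z hz)).symm, ?_⟩
  have h1 : (fun z : EuclideanSpace ℝ (Fin n) × ℝ => a z.2) =O[𝓟 Ω ×ˢ atTop]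
      fun z => z.2 ^ (-s) := ha.comp_tendsto tendsto_snd
  refine IsBigO.trans (IsBigO.of_bound 2 ?_) h1
  filter_upwards [prod_mem_prod (mem_principal_self Ω) (Ioi_mem_atTop (0 : ℝ))] with z hz
  rw [Real.norm_eq_abs]
  have h2 := hle z hz
  have h3 : a z.2 ≤ ‖a z.2‖ := le_abs_self _
  linarith

theorem HasExpRate.tendsto_one {n : ℕ} {Ω : Set (EuclideanSpace ℝ (Fin n))}
    {u : EuclideanSpace ℝ (Fin n) × ℝ → ℝ} {s : ℝ} (hs : 0 < s) (h : HasExpRate Ω u s)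
    {x : EuclideanSpace ℝ (Fin n)} (hx : x ∈ Ω) :
    Tendsto (fun t : ℝ => u (x, t)) atTop (𝓝 1) := by
  obtain ⟨w, hw, hO⟩ := h
  have hx' : Tendsto (fun t : ℝ => (x, t)) atTop (𝓟 Ω ×ˢ atTop) :=
    (tendsto_principal.2 (Eventually.of_forall fun _ => hx)).prodMk tendsto_id
  have h0 : Tendsto (fun t : ℝ => w (x, t)) atTop (𝓝 0) :=
    (hO.comp_tendsto hx').trans_tendsto (tendsto_rpow_neg_atTop hs)
  have h1 := (Real.continuous_exp.tendsto 0).comp h0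
  rw [Real.exp_zero] at h1
  refine h1.congr' ?_
  filter_upwards [eventually_gt_atTop (0 : ℝ)] with t ht
  exact (hw (x, t) ⟨hx, ht⟩).symm

end Trudinger

/-! ### Bounds on the initial data and conclusion of the rates -/

theorem theorem1p61 {n : ℕ} (hn : 2 ≤ n) (p : ℝ≥0∞) (hp : 2 ≤ p)
    (Ω : Set (EuclideanSpace ℝ (Fin n))) (hΩ_open : IsOpen Ω) (hΩ_conn : IsConnected Ω)
    (hΩ_bdd : Bornology.IsBounded Ω)
    (f : EuclideanSpace ℝ (Fin n) → ℝ) (g : EuclideanSpace ℝ (Fin n) × ℝ → ℝ)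
    (hh : ContinuousOn (Trudinger.boundaryData f g) (Trudinger.parabolicBoundary Ω))
    (hf_inf_pos : 0 < sInf (f '' Ω)) (hf_inf : sInf (f '' Ω) ≤ 1)
    (hf_sup : 1 ≤ sSup (f '' Ω)) (hf_bdd : BddAbove (f '' Ω))
    (hg : ∀ x ∈ frontier Ω, ∀ t : ℝ, 0 ≤ t → g (x, t) = 1)
    (u : EuclideanSpace ℝ (Fin n) × ℝ → ℝ)
    (hu_cont : ContinuousOn u (Trudinger.cylinder Ω ∪ Trudinger.parabolicBoundary Ω))
    (hu_pos : ∀ z ∈ Trudinger.cylinder Ω ∪ Trudinger.parabolicBoundary Ω, 0 < u z)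
    (hu_sol : Trudinger.IsViscositySolution p (Trudinger.cylinder Ω) u)
    (hu_init : ∀ x ∈ closure Ω, u (x, 0) = f x)
    (hu_lat : ∀ x ∈ frontier Ω, ∀ t : ℝ, 0 ≤ t → u (x, t) = g (x, t)) :
    (∀ x ∈ Ω, Tendsto (fun t : ℝ => u (x, t)) atTop (𝓝 1)) ∧
      (p = 2 → ∀ s : ℝ, 0 < s → Trudinger.HasExpRate Ω u s) ∧
      (2 < p → p < ⊤ → Trudinger.HasExpRate Ω u (1 / (p.toReal - 2))) ∧
      (p = ⊤ → Trudinger.HasExpRate Ω u (1 / 2)) := by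

  have hsub := Trudinger.closure_prod_Ici_subset hΩ_open
  have hlat : ∀ x ∈ frontier Ω, ∀ t : ℝ, 0 ≤ t → u (x, t) = 1 := fun x hx t ht =>
    (hu_lat x hx t ht).trans (hg x hx t ht)
  -- In `ℝ` the infimum of a set unbounded below is 0 by convention, so a positive `sInf` forces
  -- boundedness.
  have hf_below : BddBelow (f '' Ω) := by
    by_contra h
    rw [Real.sInf_of_not_bddBelow h] at hf_inf_pos
    exact lt_irrefl _ hf_inf_pos
  set M := sSup (f '' Ω) with hM
  set m := sInf (f '' Ω) with hm
  have hlogM : 0 ≤ Real.log M := Real.log_nonneg hf_sup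
  have hlogm : Real.log m ≤ 0 := Real.log_nonpos hf_inf_pos.le hf_inf
  -- The summand 1 keeps the bound positive when `m = M = 1`, since `exists_abs_log_le` needs `0 <
  -- a₀`. The infimum and supremum run over `Ω` only; on the frontier the lateral value 1 is used.
  have hinit : ∀ x ∈ closure Ω, |Real.log (u (x, 0))| ≤ 1 + Real.log M - Real.log m := by
    intro x hx
    by_cases hxΩ : x ∈ Ω
    · rw [hu_init x hx]
      have h1 : m ≤ f x := csInf_le hf_below (mem_image_of_mem f hxΩ)
      have h2 : f x ≤ M := le_csSup hf_bdd (mem_image_of_mem f hxΩ)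
      have h3 := Real.log_le_log hf_inf_pos h1
      have h4 := Real.log_le_log (hf_inf_pos.trans_le h1) h2
      exact abs_le.2 ⟨by linarith, by linarith⟩
    · have hxf : x ∈ frontier Ω := by
        rw [hΩ_open.frontier_eq]
        exact ⟨hx, hxΩ⟩
      rw [hlat x hxf 0 le_rfl, Real.log_one, abs_zero]
      linarith
  obtain ⟨a, hle, h₂, hfin, htop⟩ := Trudinger.exists_abs_log_le ⟨0, by omega⟩ hp hΩ_open hΩ_bdd
    (hu_cont.mono hsub) (fun z hz => hu_pos z (hsub hz)) hu_sol (by linarith) hinit hlat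
  have hrate : ∀ s : ℝ, (a =O[atTop] fun t => t ^ (-s)) → Trudinger.HasExpRate Ω u s :=
    fun s hs => .of_abs_log_le (fun z hz => hu_pos z (Or.inl hz)) hle hs
  refine ⟨fun x hx => ?_, fun h s _ => hrate s (h₂ h s), fun h h' => hrate _ (hfin h h'),
    fun h => hrate _ (htop h)⟩
  rcases hp.eq_or_lt with h | h
  -- For `p = 2` any positive exponent would do.
  · exact (hrate 1 (h₂ h.symm 1)).tendsto_one one_pos hx
  · rcases eq_or_ne p ⊤ with h' | h'
    · exact (hrate _ (htop h')).tendsto_one (by norm_num) hx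
    · refine (hrate _ (hfin h h'.lt_top)).tendsto_one (one_div_pos.2 (sub_pos.2 ?_)) hx
      simpa using (ENNReal.toReal_lt_toReal (by simp) h').2 h
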